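/- Let $(X, \mathcal{B}, \mu)$ be a probability space, let $T : X \to X$ be a measurable map with $\mu(T^{-1}B) = \mu(B)$ for all $B \in \mathcal{B}$ (not assumed invertible), and let $\mathscr{P}$ be a countable partition of $X$ into measurable sets. For $n \geq 1$ let $\bigvee_{i=0}^{n-1} T^{-i}\mathscr{P}$ denote the partition of $X$ into the nonempty sets of the form $\bigcap_{i=0}^{n-1} T^{-i}A_i$ with $A_0, \dots, A_{n-1} \in \mathscr{P}$; conditioning on a partition means conditioning on the $\sigma$-algebra it generates. Let $1 < p \leq \infty$ and let $f \in L^p(\mu)$ be real- or complex-valued. Then for $\mu$-almost every $x \in X$, $$ \lim_{n, k \to \infty} \mathbb{E}\left[ \frac{1}{k} \sum_{j=0}^{k-1} f \circ T^j \;\middle|\; \bigvee_{i=0}^{n-1} T^{-i}\mathscr{P} \right](x) = \mathbb{E}\left[ f \mid \mathfrak{I} \cap \mathfrak{P} \right](x), $$ where the limit is a joint (double) limit as $n$ and $k$ tend to infinity independently, $\mathfrak{I} = \{B \in \mathcal{B} : T^{-1}B = B\}$ is the $\sigma$-algebra of $T$-invariant measurable subsets of $X$, and $\mathfrak{P}$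 is the $\sigma$-algebra generated by $\bigcup_{n=1}^\infty \bigvee_{i=0}^{n-1} T^{-i}\mathscr{P}$. -/

import Mathlib

open MeasureTheory Filter Topology

/-- The join `⋁_{i < n} T^{-i} 𝒫` of the first `n` pullbacks of a partition `𝒫` of `X`:
the collection of all nonempty cells `⋂_{i < n} T^{-i} A_i` with `A_i ∈ 𝒫`
(for `n = 0` this is the trivial partition `{X}`). -/
def iteratedJoin {X : Type*} (T : X → X) (P : Set (Set X)) (n : ℕ) : Set (Set X) :=
  {C | C.Nonempty ∧ ∃ A : Fin n → Set X, (∀ i, A i ∈ P) ∧ C = ⋂ i : Fin n, T^[i] ⁻¹' A i}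

/-!
Write `A_k f` for the Birkhoff averages of `f`, `ℱ n` for the σ-algebra of the `n`-th join, `𝔓` for
the join of the `ℱ n`, and `ℐ` for the invariant σ-algebra. Taking real and imaginary parts reduces
the claim to real `f`.

By Birkhoff's theorem (`ae_tendsto_birkhoffAverage`) `A_k f → g = 𝔼[f | ℐ]` almost everywhere. The
hypothesis `1 < p` enters only through the ergodic maximal function `sup_k A_k |f|`: it is
integrable (`integrable_iSup_birkhoffAverage`), by the weak type inequality applied to a power of `|f|` and
Jensen's inequality. Hence the tails `D_K = sup_{k ≥ K} |A_k f - g|` are dominated by an integrable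
function, and `𝔼[D_K | 𝔓]` decreases to `0`. For `k ≥ K`,
`|𝔼[A_k f | ℱ n] - 𝔼[g | ℱ n]| ≤ 𝔼[D_K | ℱ n]`, and by Lévy's upward theorem the right side tends to
`𝔼[D_K | 𝔓]` and `𝔼[g | ℱ n]` tends to `𝔼[g | 𝔓]` as `n → ∞`. This makes the double limit
`𝔼[𝔼[f | ℐ] | 𝔓]` (`ae_tendsto_condExp_prod_of_dominated`).

It remains to identify this with `𝔼[f | ℐ ⊓ 𝔓]` (`condExp_condExp_invariants`). Since `T` is
measurable for `𝔓`, the averages of the indicator of a set `A` of `𝔓` are `𝔓`-measurable, hence so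
is their limit `𝔼[1_A | ℐ]`, which is therefore `𝔼[1_A | ℐ ⊓ 𝔓]`; self-adjointness of conditional
expectation transfers this from indicators to `f`.

Both the maximal inequality and Birkhoff's theorem come from the running maximum of the Birkhoff
sums (`birkhoffMax`) and its recursion `M_{n+1} = max 0 (φ + M_n ∘ T)`.
-/

/-! ### The maximal ergodic inequality and Birkhoff's theorem -/

/-- The running maximum `max_{0 ≤ k ≤ n} ∑_{j < k} φ ∘ T^j` of the Birkhoff sums, defined by the
recursion that the maximal inequality uses. -/
def birkhoffMax {X : Type*} (T : X → X) (φ : X → ℝ) : ℕ → X → ℝ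
  | 0, _ => 0
  | n + 1, x => max 0 (φ x + birkhoffMax T φ n (T x))

section BirkhoffMax

variable {X : Type*} {T : X → X} {φ : X → ℝ}

theorem birkhoffMax_nonneg (n : ℕ) (x : X) : 0 ≤ birkhoffMax T φ n x := by
  cases n with
  | zero => exact le_rfl
  | succ n => exact le_max_left _ _

theorem birkhoffMax_le_succ (n : ℕ) (x : X) :
    birkhoffMax T φ n x ≤ birkhoffMax T φ (n + 1) x := by
  induction n generalizing x with
  | zero => exact birkhoffMax_nonneg 1 x
  | succ n ih => exact max_le_max le_rfl (by have := ih (T x); linarith)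

theorem monotone_birkhoffMax (x : X) : Monotone fun n => birkhoffMax T φ n x :=
  monotone_nat_of_le_succ fun n => birkhoffMax_le_succ n x

theorem birkhoffSum_le_birkhoffMax (n : ℕ) (x : X) :
    birkhoffSum T φ n x ≤ birkhoffMax T φ n x := by
  induction n generalizing x with
  | zero => simp [birkhoffMax]
  | succ n ih =>
    rw [birkhoffSum_succ']
    exact le_max_of_le_right (by have := ih (T x); linarith)

theorem birkhoffMax_succ_sub (n : ℕ) (x : X) :
    birkhoffMax T φ (n + 1) x - birkhoffMax T φ n (T x) =
      max (-birkhoffMax T φ n (T x)) (φ x) := by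
  rw [birkhoffMax, ← max_sub_sub_right]
  congr 1 <;> ring

/-- Unboundedness of the Birkhoff sums from above is a `T`-invariant property of the orbit. -/
theorem bddAbove_birkhoffMax_apply (x : X) :
    BddAbove (Set.range fun n => birkhoffMax T φ n (T x)) ↔
      BddAbove (Set.range fun n => birkhoffMax T φ n x) := by
  constructor
  · rintro ⟨C, hC⟩
    refine ⟨max 0 (φ x + C), ?_⟩
    rintro _ ⟨n, rfl⟩
    refine (birkhoffMax_le_succ n x).trans (max_le_max le_rfl ?_)
    have := hC ⟨n, rfl⟩
    simp only at this
    linarith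
  · rintro ⟨C, hC⟩
    refine ⟨C - φ x, ?_⟩
    rintro _ ⟨n, rfl⟩
    have h1 : birkhoffMax T φ (n + 1) x ≤ C := hC ⟨n + 1, rfl⟩
    have h2 : φ x + birkhoffMax T φ n (T x) ≤ birkhoffMax T φ (n + 1) x := le_max_right _ _
    simp only
    linarith

variable [MeasurableSpace X] {μ : Measure X}

theorem measurable_birkhoffMax (hT : Measurable T) (hφ : Measurable φ) (n : ℕ) :
    Measurable (birkhoffMax T φ n) := by
  induction n with
  | zero => exact measurable_const
  | succ n ih => exact measurable_const.max (hφ.add (ih.comp hT))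

theorem integrable_birkhoffMax (hT : MeasurePreserving T μ μ) (hφ : Integrable φ μ) (n : ℕ) :
    Integrable (birkhoffMax T φ n) μ := by
  induction n with
  | zero => exact integrable_zero _ _ _
  | succ n ih =>
    exact (integrable_zero X ℝ μ).sup (hφ.add (hT.integrable_comp_of_integrable ih))

/-- The **maximal ergodic inequality**. -/
theorem setIntegral_birkhoffMax_pos_nonneg (hT : MeasurePreserving T μ μ) (hφm : Measurable φ)
    (hφ : Integrable φ μ) (n : ℕ) : 0 ≤ ∫ x in {x | 0 < birkhoffMax T φ n x}, φ x ∂μ := by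
  cases n with
  | zero => simp [birkhoffMax]
  | succ n =>
    have hE : MeasurableSet {x | 0 < birkhoffMax T φ (n + 1) x} :=
      measurableSet_lt measurable_const (measurable_birkhoffMax hT.measurable hφm _)
    have hi := integrable_birkhoffMax hT hφ
    have hci (n : ℕ) : Integrable (fun x => birkhoffMax T φ n (T x)) μ :=
      hT.integrable_comp_of_integrable (hi n)
    have hcomp : ∫ x, birkhoffMax T φ n (T x) ∂μ = ∫ x, birkhoffMax T φ n x ∂μ := by
      conv_rhs => rw [← hT.map_eq]
      rw [integral_map hT.aemeasurable]
      rw [hT.map_eq]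
      exact (hi n).aestronglyMeasurable
    rw [← integral_indicator hE]
    calc (0 : ℝ) ≤ ∫ x, birkhoffMax T φ (n + 1) x ∂μ - ∫ x, birkhoffMax T φ n x ∂μ :=
          sub_nonneg.2 (integral_mono (hi n) (hi (n + 1)) (birkhoffMax_le_succ n))
      _ = ∫ x, (birkhoffMax T φ (n + 1) x - birkhoffMax T φ n (T x)) ∂μ := by
          rw [integral_sub (hi _) (hci n), hcomp]
      _ ≤ _ := by
          refine integral_mono ((hi _).sub (hci n))
            (hφ.indicator hE) fun x => ?_
          by_cases hx : 0 < birkhoffMax T φ (n + 1) x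
          · rw [Set.indicator_of_mem (by exact hx)]
            have : birkhoffMax T φ (n + 1) x = φ x + birkhoffMax T φ n (T x) := by
              rw [birkhoffMax] at hx ⊢
              exact max_eq_right ((lt_max_iff.1 hx).resolve_left (lt_irrefl _)).le
            simp only
            linarith
          · rw [Set.indicator_of_notMem (by exact hx)]
            have := birkhoffMax_nonneg (T := T) (φ := φ) n (T x)
            simp only
            linarith [not_lt.1 hx]

/-- The Birkhoff sums of `φ` can only be unbounded above on a set where `φ` has nonnegative
integral. -/
theorem setIntegral_not_bddAbove_birkhoffMax_nonneg (hT : MeasurePreserving T μ μ)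
    (hφm : Measurable φ) (hφ : Integrable φ μ) :
    0 ≤ ∫ x in {x | ¬ BddAbove (Set.range fun n => birkhoffMax T φ n x)}, φ x ∂μ := by
  set A := {x | ¬ BddAbove (Set.range fun n => birkhoffMax T φ n x)} with hA
  have hAm : MeasurableSet A :=
    (measurableSet_bddAbove_range (measurable_birkhoffMax hT.measurable hφm)).compl
  have hAT : T ⁻¹' A = A := by
    ext x
    exact not_congr (bddAbove_birkhoffMax_apply x)
  have hi := integrable_birkhoffMax hT hφ
  have hci (n : ℕ) : Integrable (fun x => birkhoffMax T φ n (T x)) μ :=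
    hT.integrable_comp_of_integrable (hi n)
  have hcomp (n : ℕ) : ∫ x in A, birkhoffMax T φ n (T x) ∂μ = ∫ x in A, birkhoffMax T φ n x ∂μ := by
    conv_rhs => rw [← hT.map_eq]
    rw [setIntegral_map hAm _ hT.aemeasurable, hAT]
    rw [hT.map_eq]
    exact (hi n).aestronglyMeasurable
  have hlim : Tendsto
      (fun n => ∫ x in A, (birkhoffMax T φ (n + 1) x - birkhoffMax T φ n (T x)) ∂μ) atTop
      (𝓝 (∫ x in A, φ x ∂μ)) := by
    refine tendsto_integral_of_dominated_convergence (fun x => |φ x|)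
      (fun n => ((hi _).sub (hci n)).aestronglyMeasurable.restrict)
      hφ.abs.integrableOn (fun n => Eventually.of_forall fun x => ?_) ?_
    -- The increments are `max (-M n (T x)) (φ x)` with `M n ≥ 0`, so `|φ|` dominates them, and
    -- they equal `φ x` once `M n (T x)` is large.
    · simp only [birkhoffMax_succ_sub]
      have := birkhoffMax_nonneg (T := T) (φ := φ) n (T x)
      rw [Real.norm_eq_abs, abs_le]
      exact ⟨(neg_abs_le _).trans (le_max_right _ _),
        max_le (by have := abs_nonneg (φ x); linarith) (le_abs_self _)⟩
    · refine (ae_restrict_mem hAm).mono fun x hx => ?_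
      simp only [birkhoffMax_succ_sub]
      refine tendsto_const_nhds.congr' ?_
      have hTx : T x ∈ A := by rwa [← Set.mem_preimage, hAT]
      have := tendsto_atTop_atTop_of_monotone'
        (monotone_birkhoffMax (T := T) (φ := φ) (T x)) hTx
      filter_upwards [this.eventually_ge_atTop (-φ x)] with n hn
      exact (max_eq_right (by linarith)).symm
  refine ge_of_tendsto' hlim fun n => ?_
  rw [integral_sub (hi _).integrableOn (hci n).integrableOn,
    hcomp, sub_nonneg]
  exact integral_mono (hi n).integrableOn (hi (n + 1)).integrableOn (birkhoffMax_le_succ n)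

/-- Half of the ergodic theorem: if `g` is invariant and has the same integrals as `f` over
invariant sets, then `f - g - ε` has integral `-ε μ(A)` over the invariant set `A` where its
Birkhoff sums are unbounded above. That integral is nonnegative, so `A` is null. -/
theorem ae_birkhoffSum_le [IsFiniteMeasure μ] (hT : MeasurePreserving T μ μ) {f g : X → ℝ}
    (hfm : Measurable f) (hf : Integrable f μ) (hgm : Measurable[MeasurableSpace.invariants T] g)
    (hg : Integrable g μ)
    (hfg : ∀ A, MeasurableSet[MeasurableSpace.invariants T] A → ∫ x in A, f x ∂μ = ∫ x in A, g x ∂μ)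
    {ε : ℝ} (hε : 0 < ε) :
    ∀ᵐ x ∂μ, ∃ C, ∀ n : ℕ, birkhoffSum T f n x ≤ n * (g x + ε) + C := by
  set φ : X → ℝ := fun x => f x - (g x + ε) with hφdef
  have hgm' : Measurable g := hgm.mono (MeasurableSpace.invariants_le T) le_rfl
  have hφm : Measurable φ := hfm.sub (hgm'.add_const ε)
  have hgε : Integrable (fun x => g x + ε) μ := hg.add (integrable_const ε)
  have hφ : Integrable φ μ := hf.sub hgε
  set A := {x | ¬ BddAbove (Set.range fun n => birkhoffMax T φ n x)} with hA
  have hAm : MeasurableSet[MeasurableSpace.invariants T] A :=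
    ⟨(measurableSet_bddAbove_range (measurable_birkhoffMax hT.measurable hφm)).compl, by
      ext x
      exact not_congr (bddAbove_birkhoffMax_apply x)⟩
  have h0 := setIntegral_not_bddAbove_birkhoffMax_nonneg hT hφm hφ
  rw [← hA, integral_sub hf.integrableOn hgε.integrableOn,
    integral_add hg.integrableOn (integrable_const ε).integrableOn, hfg A hAm] at h0
  have hA0 : μ A = 0 := by
    rw [← measureReal_eq_zero_iff]
    simp only [sub_add_cancel_left, setIntegral_const, smul_eq_mul] at h0
    have := measureReal_nonneg (μ := μ) (s := A)
    nlinarith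
  have hgT (j : ℕ) (x : X) : g (T^[j] x) = g x := by
    have := MeasurableSpace.comp_eq_of_measurable_invariants hgm
    induction j with
    | zero => rfl
    | succ j ih => rw [Function.iterate_succ_apply', ← ih]; exact congrFun this _
  filter_upwards [measure_eq_zero_iff_ae_notMem.1 hA0] with x hx
  obtain ⟨C, hC⟩ := not_not.1 hx
  refine ⟨C, fun n => ?_⟩
  have h1 := (birkhoffSum_le_birkhoffMax (T := T) (φ := φ) n x).trans (hC ⟨n, rfl⟩)
  have h2 : birkhoffSum T φ n x = birkhoffSum T f n x - n * (g x + ε) := by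
    simp [birkhoffSum, hφdef, hgT]
    ring
  linarith

end BirkhoffMax

/-- **Birkhoff's pointwise ergodic theorem**, with the limit identified as the conditional
expectation on the invariant σ-algebra. -/
theorem ae_tendsto_birkhoffAverage {X : Type*} [MeasurableSpace X] {μ : Measure X}
    [IsFiniteMeasure μ] {T : X → X} (hT : MeasurePreserving T μ μ) {f : X → ℝ}
    (hfm : Measurable f) (hf : Integrable f μ) :
    ∀ᵐ x ∂μ, Tendsto (fun n => birkhoffAverage ℝ T f n x) atTop
      (𝓝 ((μ[f | MeasurableSpace.invariants T]) x)) := by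
  have hI := MeasurableSpace.invariants_le T
  set g := μ[f | MeasurableSpace.invariants T] with hg
  have hgm : Measurable[MeasurableSpace.invariants T] g := stronglyMeasurable_condExp.measurable
  have hgi : Integrable g μ := integrable_condExp
  have key (m : ℕ) : ∀ᵐ x ∂μ, (∃ C, ∀ n : ℕ,
      birkhoffSum T f n x ≤ n * (g x + 1 / ((m : ℝ) + 1)) + C) ∧ ∃ C, ∀ n : ℕ,
      birkhoffSum T (-f) n x ≤ n * ((-g) x + 1 / ((m : ℝ) + 1)) + C := by
    have hm : (0 : ℝ) < 1 / ((m : ℝ) + 1) := by positivity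
    have hfg (A : Set X) (hA : MeasurableSet[MeasurableSpace.invariants T] A) :
        ∫ x in A, f x ∂μ = ∫ x in A, g x ∂μ := (setIntegral_condExp hI hf hA).symm
    refine (ae_birkhoffSum_le hT hfm hf hgm hgi hfg hm).and
      (ae_birkhoffSum_le hT hfm.neg hf.neg hgm.neg hgi.neg (fun A hA => ?_) hm)
    simp only [Pi.neg_apply, integral_neg, hfg A hA]
  filter_upwards [ae_all_iff.2 key] with x hx
  rw [Metric.tendsto_atTop]
  intro ε hε
  obtain ⟨m, hm⟩ := exists_nat_one_div_lt (half_pos hε)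
  obtain ⟨⟨C, hC⟩, C', hC'⟩ := hx m
  obtain ⟨N, hN⟩ := exists_nat_gt (max (C / (ε / 2)) (C' / (ε / 2)))
  refine ⟨N + 1, fun n hn => ?_⟩
  have hn0 : (0 : ℝ) < n := by exact_mod_cast (by omega : 0 < n)
  have hNn : (N : ℝ) ≤ n := by exact_mod_cast (by omega : N ≤ n)
  have h1 : C < n * (ε / 2) := (div_lt_iff₀ (half_pos hε)).1
    ((le_max_left _ _).trans_lt (hN.trans_le hNn))
  have h2 : C' < n * (ε / 2) := (div_lt_iff₀ (half_pos hε)).1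
    ((le_max_right _ _).trans_lt (hN.trans_le hNn))
  have h3 := hC n
  have h4 := hC' n
  rw [birkhoffSum_neg, Pi.neg_apply] at h4
  have h5 := mul_lt_mul_of_pos_left hm hn0
  rw [Real.dist_eq, birkhoffAverage, smul_eq_mul, abs_lt]
  constructor
  · rw [lt_sub_iff_add_lt, lt_inv_mul_iff₀ hn0]
    linarith
  · rw [sub_lt_iff_lt_add, inv_mul_lt_iff₀ hn0]
    linarith

/-! ### Integrability of the ergodic maximal function -/

/-- Jensen's inequality for Birkhoff averages. -/
theorem birkhoffAverage_rpow_le {X : Type*} {T : X → X} {f : X → ℝ} (hf0 : 0 ≤ f) {q : ℝ}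
    (hq : 1 ≤ q) {k : ℕ} (hk : k ≠ 0) (x : X) :
    birkhoffAverage ℝ T f k x ^ q ≤ birkhoffAverage ℝ T (fun y => f y ^ q) k x := by
  have := Real.rpow_arith_mean_le_arith_mean_rpow (Finset.range k) (fun _ => (k : ℝ)⁻¹)
    (fun j => f (T^[j] x)) (fun _ _ => by positivity) (by simp [hk]) (fun j _ => hf0 _) hq
  simpa only [birkhoffAverage, birkhoffSum, smul_eq_mul, Finset.mul_sum] using this

theorem measurable_birkhoffAverage {X : Type*} {m : MeasurableSpace X} {T : X → X}
    (hT : Measurable T) {f : X → ℝ} (hf : Measurable f) (k : ℕ) :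
    Measurable (birkhoffAverage ℝ T f k) := by
  have : Measurable fun x => ∑ j ∈ Finset.range k, f (T^[j] x) :=
    Finset.measurable_fun_sum _ fun j _ => hf.comp (hT.iterate j)
  exact this.const_smul (k : ℝ)⁻¹

theorem integrable_birkhoffAverage {X E : Type*} [NormedAddCommGroup E] [NormedSpace ℝ E]
    [MeasurableSpace X] {μ : Measure X} {T : X → X} (hT : MeasurePreserving T μ μ) {f : X → E}
    (hf : Integrable f μ) (k : ℕ) :
    Integrable (birkhoffAverage ℝ T f k) μ := by
  have : Integrable (fun x => ∑ j ∈ Finset.range k, f (T^[j] x)) μ :=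
    integrable_finsetSum _ fun j _ => (hT.iterate j).integrable_comp_of_integrable hf
  exact this.smul (k : ℝ)⁻¹

section MaximalFunction

variable {X : Type*} [MeasurableSpace X] {μ : Measure X} [IsProbabilityMeasure μ] {T : X → X}

/-- The weak type `(1, 1)` inequality for the ergodic maximal function. -/
theorem measure_exists_mul_lt_birkhoffSum_le (hT : MeasurePreserving T μ μ) {g : X → ℝ}
    (hgm : Measurable g) (hg : Integrable g μ) (hg0 : 0 ≤ g) {c : ℝ} (hc : 0 < c) :
    μ {x | ∃ k : ℕ, k * c < birkhoffSum T g k x} ≤ ENNReal.ofReal ((∫ x, g x ∂μ) / c) := by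
  set φ : X → ℝ := fun x => g x - c with hφdef
  have hφm : Measurable φ := hgm.sub_const c
  have hφ : Integrable φ μ := hg.sub (integrable_const c)
  have hsub : {x | ∃ k : ℕ, k * c < birkhoffSum T g k x} ⊆
      ⋃ n, {x | 0 < birkhoffMax T φ n x} := by
    rintro x ⟨k, hk⟩
    refine Set.mem_iUnion.2 ⟨k, lt_of_lt_of_le ?_ (birkhoffSum_le_birkhoffMax k x)⟩
    have : birkhoffSum T φ k x = birkhoffSum T g k x - k * c := by
      simp [birkhoffSum, hφdef]
    linarith
  have hmono : Monotone fun n => {x | 0 < birkhoffMax T φ n x} := fun m n hmn x hx =>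
    lt_of_lt_of_le hx (monotone_birkhoffMax x hmn)
  refine (measure_mono hsub).trans (le_of_tendsto' (tendsto_measure_iUnion_atTop hmono) fun n => ?_)
  have hE : MeasurableSet {x | 0 < birkhoffMax T φ n x} :=
    measurableSet_lt measurable_const (measurable_birkhoffMax hT.measurable hφm _)
  have h0 := setIntegral_birkhoffMax_pos_nonneg hT hφm hφ n
  rw [integral_sub hg.integrableOn (integrable_const c).integrableOn, setIntegral_const,
    smul_eq_mul] at h0
  have h1 := setIntegral_le_integral (s := {x | 0 < birkhoffMax T φ n x}) hg (.of_forall hg0)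
  rw [Function.comp_apply, ← ofReal_measureReal]
  refine ENNReal.ofReal_le_ofReal ?_
  rw [le_div_iff₀ hc]
  linarith

/-- The ergodic maximal function of a nonnegative function in `L^q`, `1 < q`, is integrable: by
Jensen's inequality it exceeds `t` only where the maximal function of `f ^ q` exceeds `t ^ q`, so
its distribution function is `O(t ^ (-q))`. -/
theorem integrable_iSup_birkhoffAverage (hT : MeasurePreserving T μ μ) {f : X → ℝ}
    (hfm : Measurable f) (hf0 : 0 ≤ f) {q : ℝ} (hq : 1 < q)
    (hfq : Integrable (fun x => f x ^ q) μ) :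
    Integrable (fun x => ⨆ k, birkhoffAverage ℝ T f k x) μ := by
  have hm : Measurable fun x => ⨆ k, birkhoffAverage ℝ T f k x :=
    Measurable.iSup fun k => measurable_birkhoffAverage hT.measurable hfm k
  have hA0 (k : ℕ) (x : X) : 0 ≤ birkhoffAverage ℝ T f k x :=
    mul_nonneg (by positivity) (Finset.sum_nonneg fun j _ => hf0 _)
  have hF0 (x : X) : 0 ≤ ⨆ k, birkhoffAverage ℝ T f k x := Real.iSup_nonneg fun k => hA0 k x
  set I := ∫ x, f x ^ q ∂μ
  have hI : 0 ≤ I := integral_nonneg fun x => Real.rpow_nonneg (hf0 x) q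
  have hweak {t : ℝ} (ht : 0 < t) : μ {x | t < ⨆ k, birkhoffAverage ℝ T f k x} ≤
      ENNReal.ofReal (I * t ^ (-q)) := by
    rw [Real.rpow_neg ht.le, ← div_eq_mul_inv]
    refine (measure_mono fun x hx => ?_).trans (measure_exists_mul_lt_birkhoffSum_le hT
      (hfm.pow_const q) hfq (fun x => Real.rpow_nonneg (hf0 x) q) (Real.rpow_pos_of_pos ht q))
    -- This holds even where the family is unbounded: there the real supremum is `0`, and `0 < t`.
    obtain ⟨k, hk⟩ := exists_lt_of_lt_ciSup (show t < ⨆ k, birkhoffAverage ℝ T f k x from hx)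
    have hk0 : k ≠ 0 := by
      rintro rfl
      rw [birkhoffAverage_zero] at hk
      exact lt_asymm ht hk
    have h1 := (Real.rpow_lt_rpow ht.le hk (by linarith)).trans_le
      (birkhoffAverage_rpow_le hf0 hq.le hk0 x)
    rw [birkhoffAverage, smul_eq_mul, lt_inv_mul_iff₀ (by positivity)] at h1
    exact ⟨k, h1⟩
  -- Layer cake: the distribution function is at most `1` on `(0, 1]`, and `O(t ^ (-q))` beyond.
  refine ⟨hm.aestronglyMeasurable, ?_⟩
  rw [hasFiniteIntegral_iff_ofReal (.of_forall hF0),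
    lintegral_eq_lintegral_meas_lt μ (.of_forall hF0) hm.aemeasurable,
    ← Set.Ioc_union_Ioi_eq_Ioi zero_le_one,
    lintegral_union measurableSet_Ioi (Set.Ioc_disjoint_Ioi le_rfl)]
  refine ENNReal.add_lt_top.2 ⟨?_, ?_⟩
  · refine (lintegral_mono fun t => prob_le_one).trans_lt ?_
    simp
  · refine (setLIntegral_mono' measurableSet_Ioi
      fun t ht => hweak (zero_lt_one.trans ht)).trans_lt ?_
    exact ((integrableOn_Ioi_rpow_of_lt (by linarith) zero_lt_one).const_mul I).lintegral_lt_top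

end MaximalFunction

/-! ### Conditioning on invariant sets -/

section Commuting

theorem measurable_limUnder_birkhoffAverage {X : Type*} {m : MeasurableSpace X} {T : X → X}
    (hT : Measurable T) {u : X → ℝ} (hu : Measurable u) :
    Measurable fun x => limUnder atTop fun n => birkhoffAverage ℝ T u n x :=
  (StronglyMeasurable.limUnder fun n =>
    (measurable_birkhoffAverage hT hu n).stronglyMeasurable).measurable

variable {X : Type*} {m : MeasurableSpace X} [m0 : MeasurableSpace X] {μ : Measure X} {T : X → X}

/-- Conditional expectation is self-adjoint, here as a pairing of a bounded with an integrable
function. -/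
theorem integral_condExp_mul_eq [IsFiniteMeasure μ] (hm : m ≤ m0)
    {u f : X → ℝ} {C : ℝ} (hu : AEStronglyMeasurable u μ) (huC : ∀ x, |u x| ≤ C)
    (hf : Integrable f μ) :
    ∫ x, (μ[u | m]) x * f x ∂μ = ∫ x, u x * (μ[f | m]) x ∂μ := by
  have hui : Integrable u μ := Integrable.of_bound hu C (.of_forall huC)
  have hbdd : ∀ᵐ x ∂μ, ‖(μ[u | m]) x‖ ≤ C :=
    ae_bdd_abs_condExp_of_ae_bdd_abs (.of_forall huC)
  have h1 : μ[μ[u | m] * f | m] =ᵐ[μ] μ[u | m] * μ[f | m] :=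
    condExp_stronglyMeasurable_mul_of_bound hm stronglyMeasurable_condExp hf C hbdd
  have h2 : μ[u * μ[f | m] | m] =ᵐ[μ] μ[u | m] * μ[f | m] :=
    condExp_mul_of_stronglyMeasurable_right stronglyMeasurable_condExp
      (integrable_condExp.bdd_mul hu (.of_forall huC)) hui
  calc ∫ x, (μ[u | m]) x * f x ∂μ = ∫ x, (μ[μ[u | m] * f | m]) x ∂μ := (integral_condExp hm).symm
    _ = ∫ x, (μ[u * μ[f | m] | m]) x ∂μ := integral_congr_ae (h1.trans h2.symm)
    _ = ∫ x, u x * (μ[f | m]) x ∂μ := integral_condExp hm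

/-- The invariant conditional expectation of a bounded `m`-measurable function is a limit of its
Birkhoff averages, hence it is `m`-measurable too, as soon as `T` is measurable for `m`. -/
theorem condExp_invariants_ae_eq_condExp_inf [IsFiniteMeasure μ] (hT : MeasurePreserving T μ μ)
    (hm : m ≤ m0) (hTm : Measurable[m, m] T) {u : X → ℝ}
    (hu : Measurable[m] u) {C : ℝ} (huC : ∀ x, |u x| ≤ C) :
    μ[u | MeasurableSpace.invariants T] =ᵐ[μ] μ[u | MeasurableSpace.invariants T ⊓ m] := by
  have hI := MeasurableSpace.invariants_le T
  have hIm : MeasurableSpace.invariants T ⊓ m ≤ m0 := inf_le_right.trans hm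
  have hu0 : Measurable u := hu.mono hm le_rfl
  have hui : Integrable u μ := Integrable.of_bound hu0.aestronglyMeasurable C (.of_forall huC)
  set v : X → ℝ := fun x => limUnder atTop fun n => birkhoffAverage ℝ T u n x with hv
  have hvm : Measurable[m] v := measurable_limUnder_birkhoffAverage hTm hu
  -- `u` is bounded, so its averages along the orbits of `x` and `T x` are asymptotically equal:
  -- they converge to the same limits, and `limUnder` takes the same default value otherwise.
  have hvT (x : X) : v (T x) = v x := by
    have h0 := tendsto_birkhoffAverage_apply_sub_birkhoffAverage' ℝ (g := u)
      (isBounded_iff_forall_norm_le.2 ⟨C, by rintro _ ⟨y, rfl⟩; exact huC y⟩) T x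
    have (l : ℝ) : Tendsto (fun n => birkhoffAverage ℝ T u n (T x)) atTop (𝓝 l) ↔
        Tendsto (fun n => birkhoffAverage ℝ T u n x) atTop (𝓝 l) :=
      ⟨fun h => by simpa using h.sub h0, fun h => by simpa using h.add h0⟩
    simp only [hv, limUnder, lim]
    simp only [Tendsto] at this
    simp only [this]
  have hvI : Measurable[MeasurableSpace.invariants T ⊓ m] v := fun s hs =>
    ⟨⟨hm _ (hvm hs), by ext x; simp [hvT]⟩, hvm hs⟩
  have hlim : μ[u | MeasurableSpace.invariants T] =ᵐ[μ] v := by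
    filter_upwards [ae_tendsto_birkhoffAverage hT hu0 hui] with x hx using hx.limUnder_eq.symm
  have hvi : Integrable v μ := integrable_condExp.congr hlim
  calc μ[u | MeasurableSpace.invariants T] =ᵐ[μ] v := hlim
    _ = μ[v | MeasurableSpace.invariants T ⊓ m] :=
      (condExp_of_stronglyMeasurable hIm hvI.stronglyMeasurable hvi).symm
    _ =ᵐ[μ] μ[μ[u | MeasurableSpace.invariants T] | MeasurableSpace.invariants T ⊓ m] :=
      condExp_congr_ae hlim.symm
    _ =ᵐ[μ] μ[u | MeasurableSpace.invariants T ⊓ m] := condExp_condExp_of_le inf_le_left hI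

/-- If `T` is measurable for `m`, then conditioning first on the invariant σ-algebra and then on
`m` amounts to conditioning on their intersection. For `A` in `m` the integrals over `A` agree
because, by self-adjointness, only the two conditional expectations of the indicator of `A` matter. -/
theorem condExp_condExp_invariants [IsFiniteMeasure μ] (hT : MeasurePreserving T μ μ)
    (hm : m ≤ m0) (hTm : Measurable[m, m] T) {f : X → ℝ}
    (hf : Integrable f μ) :
    μ[μ[f | MeasurableSpace.invariants T] | m] =ᵐ[μ] μ[f | MeasurableSpace.invariants T ⊓ m] := by
  have hI := MeasurableSpace.invariants_le T
  have hIm : MeasurableSpace.invariants T ⊓ m ≤ m0 := inf_le_right.trans hm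
  refine (ae_eq_condExp_of_forall_setIntegral_eq hm integrable_condExp
    (fun _ _ _ => integrable_condExp.integrableOn) (fun A hA _ => ?_)
    (stronglyMeasurable_condExp.mono inf_le_right).aestronglyMeasurable).symm
  set u : X → ℝ := A.indicator fun _ => 1 with hu
  have hum : Measurable[m] u := (@measurable_const _ _ _ m 1).indicator hA
  have huC (x : X) : |u x| ≤ 1 := by
    by_cases hx : x ∈ A <;> simp [hu, hx]
  have hus : AEStronglyMeasurable u μ := (hum.mono hm le_rfl).aestronglyMeasurable
  have hset (g : X → ℝ) : ∫ x in A, g x ∂μ = ∫ x, u x * g x ∂μ := by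
    rw [← integral_indicator (hm A hA)]
    congr 1 with x
    by_cases hx : x ∈ A <;> simp [hu, hx]
  rw [hset, hset, ← integral_condExp_mul_eq hI hus huC hf,
    ← integral_condExp_mul_eq hIm hus huC hf]
  refine integral_congr_ae ?_
  filter_upwards [condExp_invariants_ae_eq_condExp_inf hT hm hTm hum huC] with x hx
  rw [hx]

end Commuting

/-! ### The double limit along a filtration -/

section DoubleLimit

variable {X : Type*} {m0 : MeasurableSpace X} {μ : Measure X} {T : X → X}

/-- If `h k → g` almost everywhere under an integrable bound, then `μ[h k | ℱ n]` converges
to `μ[g | ⨆ n, ℱ n]` as `n` and `k` tend to infinity independently. The tail suprema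
`D K = sup_{k ≥ K} |h k - g|` decrease to `0` and are dominated, so their conditional expectations
on the join decrease to `0`; for `k ≥ K` the distance of `μ[h k | ℱ n]` from `μ[g | ℱ n]` is at most
`μ[D K | ℱ n]`, to which Lévy's upward theorem applies. -/
theorem ae_tendsto_condExp_prod_of_dominated [IsFiniteMeasure μ] (ℱ : Filtration ℕ m0)
    {h : ℕ → X → ℝ} {g F : X → ℝ} (hh : ∀ k, Integrable (h k) μ) (hhm : ∀ k, Measurable (h k))
    (hg : Integrable g μ) (hgm : Measurable g) (hF : Integrable F μ)
    (hhF : ∀ᵐ x ∂μ, ∀ k, |h k x| ≤ F x)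
    (hlim : ∀ᵐ x ∂μ, Tendsto (fun k => h k x) atTop (𝓝 (g x))) :
    ∀ᵐ x ∂μ, Tendsto (fun nk : ℕ × ℕ => (μ[h nk.2 | ℱ nk.1]) x) (atTop ×ˢ atTop)
      (𝓝 ((μ[g | ⨆ n, ℱ n]) x)) := by
  set D : ℕ → X → ℝ := fun K x => ⨆ k, |h (k + K) x - g x| with hD
  have hDm (K : ℕ) : Measurable (D K) := Measurable.iSup fun k => ((hhm _).sub hgm).abs
  have hD0 (K : ℕ) (x : X) : 0 ≤ D K x := Real.iSup_nonneg fun k => abs_nonneg _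
  have hbd : ∀ᵐ x ∂μ, ∀ k, |h k x - g x| ≤ F x + |g x| := by
    filter_upwards [hhF] with x hx k
    exact (abs_sub _ _).trans (by linarith [hx k])
  have hDle : ∀ᵐ x ∂μ, ∀ K, D K x ≤ F x + |g x| := by
    filter_upwards [hbd] with x hx K
    exact ciSup_le fun k => hx _
  have hleD : ∀ᵐ x ∂μ, ∀ K k, K ≤ k → |h k x - g x| ≤ D K x := by
    filter_upwards [hbd] with x hx K k hk
    have : BddAbove (Set.range fun k => |h (k + K) x - g x|) :=
      ⟨F x + |g x|, by rintro _ ⟨j, rfl⟩; exact hx _⟩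
    simpa [Nat.sub_add_cancel hk] using le_ciSup this (k - K)
  have hFg : Integrable (fun x => F x + |g x|) μ := hF.add hg.abs
  have hDi (K : ℕ) : Integrable (D K) μ := by
    refine hFg.mono' (hDm K).aestronglyMeasurable ?_
    filter_upwards [hDle] with x hx
    rw [Real.norm_of_nonneg (hD0 K x)]
    exact hx K
  have hDlim : ∀ᵐ x ∂μ, Tendsto (fun K => D K x) atTop (𝓝 0) := by
    filter_upwards [hlim] with x hx
    rw [Metric.tendsto_atTop] at hx ⊢
    intro ε hε
    obtain ⟨N, hN⟩ := hx (ε / 2) (half_pos hε)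
    refine ⟨N, fun K hK => ?_⟩
    rw [Real.dist_0_eq_abs, abs_of_nonneg (hD0 K x)]
    exact (ciSup_le fun k => (hN (k + K) (by omega)).le).trans_lt (half_lt_self hε)
  have hint : Tendsto (fun K => ∫ x, D K x ∂μ) atTop (𝓝 0) := by
    have := tendsto_integral_of_dominated_convergence (f := fun _ => (0 : ℝ)) _
      (fun K => (hDm K).aestronglyMeasurable) hFg
      (fun K => hDle.mono fun x hx => by rw [Real.norm_of_nonneg (hD0 K x)]; exact hx K) hDlim
    simpa using this
  set 𝒢 := ⨆ n, ℱ n with h𝒢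
  have h𝒢le : 𝒢 ≤ m0 := iSup_le ℱ.le
  have hcanti : ∀ᵐ x ∂μ, Antitone fun K => (μ[D K | 𝒢]) x := by
    have hstep (K : ℕ) : μ[D (K + 1) | 𝒢] ≤ᵐ[μ] μ[D K | 𝒢] := by
      refine condExp_mono (hDi _) (hDi _) ?_
      filter_upwards [hleD] with x hx
      exact ciSup_le fun k => hx K _ (by omega)
    filter_upwards [ae_all_iff.2 hstep] with x hx using antitone_nat_of_succ_le hx
  have hcnonneg (K : ℕ) : 0 ≤ᵐ[μ] μ[D K | 𝒢] := condExp_nonneg (.of_forall (hD0 K))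
  have hclim : ∀ᵐ x ∂μ, Tendsto (fun K => (μ[D K | 𝒢]) x) atTop (𝓝 0) := by
    refine tendsto_of_integral_tendsto_of_antitone (F := fun _ => 0)
      (fun K => integrable_condExp) (integrable_const 0) ?_ hcanti ?_
    · simpa only [integral_condExp h𝒢le, integral_zero] using hint
    · exact ae_all_iff.2 hcnonneg
  have hdom (n k K : ℕ) (hk : K ≤ k) :
      ∀ᵐ x ∂μ, |(μ[h k | ℱ n]) x - (μ[g | ℱ n]) x| ≤ (μ[D K | ℱ n]) x := by
    have h1 : μ[h k - g | ℱ n] ≤ᵐ[μ] μ[D K | ℱ n] := by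
      refine condExp_mono ((hh k).sub hg) (hDi K) ?_
      filter_upwards [hleD] with x hx using (le_abs_self _).trans (hx K k hk)
    have h2 : μ[g - h k | ℱ n] ≤ᵐ[μ] μ[D K | ℱ n] := by
      refine condExp_mono (hg.sub (hh k)) (hDi K) ?_
      filter_upwards [hleD] with x hx
      exact (le_abs_self _).trans ((abs_sub_comm _ _).trans_le (hx K k hk))
    filter_upwards [h1, h2, condExp_sub (hh k) hg (ℱ n), condExp_sub hg (hh k) (ℱ n)]
      with x h1 h2 h3 h4
    rw [h3, Pi.sub_apply] at h1
    rw [h4, Pi.sub_apply] at h2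
    exact abs_le.2 ⟨by linarith, h1⟩
  have hdom' : ∀ᵐ x ∂μ, ∀ n k K, K ≤ k →
      |(μ[h k | ℱ n]) x - (μ[g | ℱ n]) x| ≤ (μ[D K | ℱ n]) x := by
    simpa only [ae_all_iff] using hdom
  filter_upwards [hclim, hdom', ae_all_iff.2 fun K => tendsto_ae_condExp (ℱ := ℱ) (D K),
    tendsto_ae_condExp (ℱ := ℱ) g] with x hc hd hDn hgn
  rw [Metric.tendsto_nhds]
  intro ε hε
  obtain ⟨K, hK⟩ := (hc.eventually_lt_const (half_pos hε)).exists
  have e1 := (hDn K).eventually_lt_const hK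
  have e2 := Metric.tendsto_nhds.1 hgn (ε / 2) (half_pos hε)
  filter_upwards [(e1.and e2).prod_mk (eventually_ge_atTop K)] with ⟨n, k⟩ hnk
  obtain ⟨⟨h1, h2⟩, h3⟩ := hnk
  have h4 := hd n k K h3
  rw [Real.dist_eq] at h2 ⊢
  have := abs_sub_le ((μ[h k | ℱ n]) x) ((μ[g | ℱ n]) x) ((μ[g | 𝒢]) x)
  simp only at h1 h2 ⊢
  linarith

/-- The double limit theorem for a real function and an arbitrary filtration whose join `T` is
measurable for. -/
theorem ae_tendsto_condExp_birkhoffAverage [IsProbabilityMeasure μ] (hT : MeasurePreserving T μ μ)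
    (ℱ : Filtration ℕ m0) (hTℱ : Measurable[⨆ n, ℱ n, ⨆ n, ℱ n] T) {p : ENNReal} (hp : 1 < p)
    {f : X → ℝ} (hf : MemLp f p μ) :
    ∀ᵐ x ∂μ, Tendsto (fun nk : ℕ × ℕ => (μ[birkhoffAverage ℝ T f nk.2 | ℱ nk.1]) x)
      (atTop ×ˢ atTop) (𝓝 ((μ[f | MeasurableSpace.invariants T ⊓ ⨆ n, ℱ n]) x)) := by
  wlog hfm : Measurable f generalizing f
  · obtain ⟨f', hf'm, hff'⟩ := hf.aestronglyMeasurable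
    have hA : ∀ᵐ x ∂μ, ∀ n k, (μ[birkhoffAverage ℝ T f k | ℱ n]) x =
        (μ[birkhoffAverage ℝ T f' k | ℱ n]) x := by
      simp only [ae_all_iff]
      exact fun n k => condExp_congr_ae
        (hT.quasiMeasurePreserving.birkhoffAverage_ae_eq_of_ae_eq ℝ hff' k)
    filter_upwards [this (hf.ae_eq hff') hf'm.measurable, hA, condExp_congr_ae hff'
      (m := MeasurableSpace.invariants T ⊓ ⨆ n, ℱ n)] with x hx hAx hfx
    rw [hfx]
    simpa only [hAx] using hx
  -- On a probability space `f` lies in `L^q` for the finite exponent `q = min p 2`.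
  have hfi : Integrable f μ := hf.integrable hp.le
  have hq1 : (1 : ENNReal) < min p 2 := lt_min hp (by norm_num)
  have hqtop : min p 2 ≠ ⊤ := ((min_le_right p 2).trans_lt (by norm_num)).ne
  have hfq : Integrable (fun x => |f x| ^ (min p 2).toReal) μ :=
    (hf.mono_exponent (min_le_left p 2)).integrable_norm_rpow (by positivity) hqtop
  have hq : 1 < (min p 2).toReal := by
    rwa [← ENNReal.toReal_one, ENNReal.toReal_lt_toReal ENNReal.one_ne_top hqtop]
  have hF := integrable_iSup_birkhoffAverage hT hfm.abs (fun x => abs_nonneg (f x)) hq hfq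
  have hI := MeasurableSpace.invariants_le T
  have hdom : ∀ᵐ x ∂μ, ∀ k, |birkhoffAverage ℝ T f k x| ≤
      ⨆ k, birkhoffAverage ℝ T (fun y => |f y|) k x := by
    filter_upwards [ae_tendsto_birkhoffAverage hT hfm.abs hfi.abs] with x hx k
    refine le_trans ?_ (le_ciSup hx.bddAbove_range k)
    simp only [birkhoffAverage, smul_eq_mul, abs_mul, abs_inv, Nat.abs_cast]
    gcongr
    exact Finset.abs_sum_le_sum_abs _ _
  filter_upwards [ae_tendsto_condExp_prod_of_dominated ℱ (integrable_birkhoffAverage hT hfi)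
    (measurable_birkhoffAverage hT.measurable hfm) integrable_condExp
    (stronglyMeasurable_condExp.measurable.mono hI le_rfl) hF hdom
    (ae_tendsto_birkhoffAverage hT hfm hfi),
    condExp_condExp_invariants hT (iSup_le ℱ.le) hTℱ hfi] with x hx hx'
  rwa [← hx']

end DoubleLimit

/-! ### The filtration generated by a partition -/

section Partition

variable {X : Type*} {T : X → X} {P : Set (Set X)}

theorem measurableSet_of_mem_iteratedJoin {m : MeasurableSpace X} (hT : Measurable T)
    (hP_meas : ∀ A ∈ P, MeasurableSet A) {n : ℕ} {C : Set X} (hC : C ∈ iteratedJoin T P n) :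
    MeasurableSet C := by
  obtain ⟨_, A, hA, rfl⟩ := hC
  exact MeasurableSet.iInter fun i => hT.iterate i (hP_meas _ (hA i))

/-- Refining a cell of the `n`-th join by a new last coordinate. -/
theorem iteratedJoin_inter_mem (n : ℕ) {C A : Set X} (hC : C ∈ iteratedJoin T P n) (hA : A ∈ P)
    (hne : (C ∩ T^[n] ⁻¹' A).Nonempty) : C ∩ T^[n] ⁻¹' A ∈ iteratedJoin T P (n + 1) := by
  obtain ⟨_, B, hB, rfl⟩ := hC
  refine ⟨hne, Fin.snoc B A, fun i => ?_, ?_⟩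
  · refine Fin.lastCases ?_ (fun j => ?_) i
    · simpa using hA
    · simpa using hB j
  · ext x
    simp [Fin.forall_fin_succ']

/-- Refining the preimage of a cell of the `n`-th join by a new zeroth coordinate. -/
theorem inter_preimage_iteratedJoin_mem (n : ℕ) {C A : Set X} (hC : C ∈ iteratedJoin T P n)
    (hA : A ∈ P) (hne : (A ∩ T ⁻¹' C).Nonempty) : A ∩ T ⁻¹' C ∈ iteratedJoin T P (n + 1) := by
  obtain ⟨_, B, hB, rfl⟩ := hC
  refine ⟨hne, Fin.cons A B, fun i => ?_, ?_⟩
  · refine Fin.cases ?_ (fun j => ?_) i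
    · simpa using hA
    · simpa using hB j
  · ext x
    simp [Fin.forall_fin_succ]

theorem generateFrom_iteratedJoin_le_succ (hP : Setoid.IsPartition P) (hPc : P.Countable) (n : ℕ) :
    MeasurableSpace.generateFrom (iteratedJoin T P n) ≤
      MeasurableSpace.generateFrom (iteratedJoin T P (n + 1)) := by
  refine MeasurableSpace.generateFrom_le fun C hC => ?_
  have hdecomp : C = ⋃ A ∈ P, C ∩ T^[n] ⁻¹' A := by
    rw [← Set.inter_iUnion₂, ← Set.preimage_iUnion₂, ← Set.sUnion_eq_biUnion, hP.sUnion_eq_univ,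
      Set.preimage_univ, Set.inter_univ]
  rw [hdecomp]
  refine MeasurableSet.biUnion hPc fun A hA => ?_
  rcases (C ∩ T^[n] ⁻¹' A).eq_empty_or_nonempty with he | hne
  · exact he ▸ MeasurableSpace.measurableSet_empty _
  · exact MeasurableSpace.measurableSet_generateFrom (iteratedJoin_inter_mem n hC hA hne)

theorem measurable_generateFrom_iteratedJoin (hP : Setoid.IsPartition P) (hPc : P.Countable)
    (n : ℕ) :
    Measurable[MeasurableSpace.generateFrom (iteratedJoin T P (n + 1)),
      MeasurableSpace.generateFrom (iteratedJoin T P n)] T := by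
  refine @measurable_generateFrom _ _ (MeasurableSpace.generateFrom _) _ _ fun C hC => ?_
  have hdecomp : T ⁻¹' C = ⋃ A ∈ P, A ∩ T ⁻¹' C := by
    rw [← Set.iUnion₂_inter, ← Set.sUnion_eq_biUnion, hP.sUnion_eq_univ, Set.univ_inter]
  rw [hdecomp]
  refine MeasurableSet.biUnion hPc fun A hA => ?_
  rcases (A ∩ T ⁻¹' C).eq_empty_or_nonempty with he | hne
  · exact he ▸ MeasurableSpace.measurableSet_empty _
  · exact MeasurableSpace.measurableSet_generateFrom (inter_preimage_iteratedJoin_mem n hC hA hne)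

/-- The filtration of the σ-algebras generated by the partitions `⋁_{i < n} T^{-i} P`. -/
def joinFiltration {m0 : MeasurableSpace X} (hT : Measurable T) (hP : Setoid.IsPartition P)
    (hPc : P.Countable) (hP_meas : ∀ A ∈ P, MeasurableSet A) : Filtration ℕ m0 where
  seq n := MeasurableSpace.generateFrom (iteratedJoin T P n)
  mono' := monotone_nat_of_le_succ (generateFrom_iteratedJoin_le_succ hP hPc)
  le' _ := MeasurableSpace.generateFrom_le fun _ hC =>
    measurableSet_of_mem_iteratedJoin hT hP_meas hC

/-- Because the σ-algebras increase, the trivial join `n = 0` may be added or left out. -/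
theorem iSup_generateFrom_iteratedJoin (hP : Setoid.IsPartition P) (hPc : P.Countable) :
    ⨆ n, MeasurableSpace.generateFrom (iteratedJoin T P n) =
      MeasurableSpace.generateFrom (⋃ n ≥ 1, iteratedJoin T P n) := by
  apply le_antisymm
  · refine iSup_le fun n => (generateFrom_iteratedJoin_le_succ hP hPc n).trans ?_
    exact MeasurableSpace.generateFrom_mono (Set.subset_biUnion_of_mem (u := iteratedJoin T P)
      (show n + 1 ≥ 1 by omega))
  · refine MeasurableSpace.generateFrom_le fun C hC => ?_
    obtain ⟨n, _, hC⟩ := Set.mem_iUnion₂.1 hC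
    exact le_iSup (fun n => MeasurableSpace.generateFrom (iteratedJoin T P n)) n _
      (MeasurableSpace.measurableSet_generateFrom hC)

theorem measurable_iSup_iteratedJoin (hP : Setoid.IsPartition P) (hPc : P.Countable) :
    Measurable[⨆ n, MeasurableSpace.generateFrom (iteratedJoin T P n),
      ⨆ n, MeasurableSpace.generateFrom (iteratedJoin T P n)] T := by
  rw [measurable_iff_comap_le, MeasurableSpace.comap_iSup]
  exact iSup_le fun n => (measurable_generateFrom_iteratedJoin hP hPc n).comap_le.trans
    (le_iSup (fun n => MeasurableSpace.generateFrom (iteratedJoin T P n)) (n + 1))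

end Partition

theorem mainTheorem2 {X : Type*} [MeasurableSpace X] {𝕜 : Type*} [RCLike 𝕜]
    (μ : Measure X) [IsProbabilityMeasure μ] (T : X → X) (hT : MeasurePreserving T μ μ)
    (P : Set (Set X)) (hP : Setoid.IsPartition P) (hP_countable : P.Countable)
    (hP_meas : ∀ A ∈ P, MeasurableSet A)
    (p : ENNReal) (hp : 1 < p) (f : X → 𝕜) (hf : MemLp f p μ) :
    ∀ᵐ x ∂μ, Tendsto
      (fun nk : ℕ × ℕ =>
        (μ[birkhoffAverage ℝ T f nk.2 | MeasurableSpace.generateFrom (iteratedJoin T P nk.1)]) x)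
      (atTop ×ˢ atTop)
      (𝓝 ((μ[f | MeasurableSpace.invariants T ⊓
        MeasurableSpace.generateFrom (⋃ n ≥ 1, iteratedJoin T P n)]) x)) := by
  set ℱ := joinFiltration hT.measurable hP hP_countable hP_meas
  have hTℱ : Measurable[⨆ n, ℱ n, ⨆ n, ℱ n] T := measurable_iSup_iteratedJoin hP hP_countable
  rw [← iSup_generateFrom_iteratedJoin hP hP_countable]
  change ∀ᵐ x ∂μ, Tendsto (fun nk : ℕ × ℕ => (μ[birkhoffAverage ℝ T f nk.2 | ℱ nk.1]) x)
    (atTop ×ˢ atTop) (𝓝 ((μ[f | MeasurableSpace.invariants T ⊓ ⨆ n, ℱ n]) x))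
  have hfi : Integrable f μ := hf.integrable hp.le
  have hAi (k : ℕ) : Integrable (birkhoffAverage ℝ T f k) μ := integrable_birkhoffAverage hT hfi k
  -- A real-linear functional `L` commutes with averaging and conditioning.
  have key (L : 𝕜 →L[ℝ] ℝ) : ∀ᵐ x ∂μ, Tendsto
      (fun nk : ℕ × ℕ => L ((μ[birkhoffAverage ℝ T f nk.2 | ℱ nk.1]) x)) (atTop ×ˢ atTop)
      (𝓝 (L ((μ[f | MeasurableSpace.invariants T ⊓ ⨆ n, ℱ n]) x))) := by
    have hA : ∀ᵐ x ∂μ, ∀ n k, L ((μ[birkhoffAverage ℝ T f k | ℱ n]) x) =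
        (μ[birkhoffAverage ℝ T (L ∘ f) k | ℱ n]) x := by
      simp only [ae_all_iff]
      intro n k
      have h := L.comp_condExp_comm (m := ℱ n) (hAi k)
      have hk : L ∘ birkhoffAverage ℝ T f k = birkhoffAverage ℝ T (L ∘ f) k :=
        funext fun x => map_birkhoffAverage ℝ ℝ L T f k x
      rwa [hk] at h
    filter_upwards [hA, L.comp_condExp_comm (m := MeasurableSpace.invariants T ⊓ ⨆ n, ℱ n) hfi,
      ae_tendsto_condExp_birkhoffAverage hT ℱ hTℱ hp (L.comp_memLp' hf)] with x h1 h2 h3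
    simp only [Function.comp_apply] at h2
    rw [h2]
    simpa only [h1] using h3
  filter_upwards [key RCLike.reCLM, key RCLike.imCLM] with x hre him
  simpa [RCLike.re_add_im] using ((RCLike.continuous_ofReal (K := 𝕜)).tendsto _ |>.comp hre).add
    (((RCLike.continuous_ofReal (K := 𝕜)).tendsto _ |>.comp him).mul_const (RCLike.I : 𝕜))
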